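/- Let $p$ be a prime number and let $\mathbb F$ be an algebraic closure of the prime field $\mathbb F_p$. Let $H=\mathbb F((t^{\mathbb Q}))$ be the field of Hahn series, that is, of generalized power series $\sum_{q\in\mathbb Q}a_qt^q$ with coefficients in $\mathbb F$ and well-ordered support, and let $K=\bigcup_{N\ge1}\mathbb F((t^{1/N}))\subset H$ be the subfield of Newton--Puiseux series. For every integer $n\ge0$ let $$s_n=\sum_{j\ge n}\binom{j}{n}\,t^{-1/p^{j+1}}\in H .$$ Then the Hahn series $$s=\sum_{n\ge0}t^n s_n\in H$$ is transcendental over $K$. -/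

import Mathlib

noncomputable section

namespace PuiseuxHahn

/-- The order embedding `ℤ → ℚ`, `k ↦ k / N`, for a positive integer `N`. -/
def divEmb (N : ℕ+) : ℤ ↪o ℚ :=
  OrderEmbedding.ofStrictMono (fun k : ℤ => (k : ℚ) / (N : ℕ)) (fun a b h => by
    have hN : (0 : ℚ) < ((N : ℕ) : ℚ) := by exact_mod_cast N.pos
    have hab : (a : ℚ) < (b : ℚ) := by exact_mod_cast h
    exact div_lt_div_of_pos_right hab hN)

@[simp] theorem divEmb_apply (N : ℕ+) (k : ℤ) : divEmb N k = (k : ℚ) / (N : ℕ) := rfl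

/-- The substitution `t ↦ t ^ (1 / N)`, a ring homomorphism `F((t)) → F((t ^ ℚ))`. -/
def rootEmb (F : Type*) [Field F] (N : ℕ+) : HahnSeries ℤ F →+* HahnSeries ℚ F :=
  HahnSeries.embDomainRingHom
    { toFun := fun k : ℤ => (k : ℚ) / (N : ℕ)
      map_zero' := by simp
      map_add' := fun a b => by push_cast; ring }
    (divEmb N).injective
    (fun a b => (divEmb N).le_iff_le)

theorem mem_range_rootEmb {F : Type*} [Field F] {N : ℕ+} {f : HahnSeries ℚ F} :
    f ∈ (rootEmb F N).fieldRange ↔ ∀ q ∈ f.support, ∃ k : ℤ, q = (k : ℚ) / (N : ℕ) := by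
  constructor
  · rintro ⟨g, rfl⟩ q hq
    by_contra hne
    apply hq
    apply HahnSeries.embDomain_of_notMem_range
    rintro ⟨k, hk⟩
    exact hne ⟨k, hk.symm⟩
  · intro h
    refine ⟨⟨fun k => f.coeff ((k : ℚ) / (N : ℕ)), ?_⟩, ?_⟩
    · rw [Set.isPWO_iff_isWF]
      have hf : f.support.IsWF := f.isWF_support
      rw [Set.isWF_iff_no_descending_seq] at hf ⊢
      intro u hu hmem
      exact hf (fun i => divEmb N (u i)) (fun a b hab => (divEmb N).strictMono (hu hab))
        (fun i => hmem i)
    · ext q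
      by_cases hq : ∃ k : ℤ, q = (k : ℚ) / (N : ℕ)
      · obtain ⟨k, rfl⟩ := hq
        exact HahnSeries.embDomain_coeff (f := divEmb N) (a := k)
      · have h0 : f.coeff q = 0 := by
          by_contra hne
          exact hq (h q hne)
        rw [h0]
        apply HahnSeries.embDomain_of_notMem_range
        rintro ⟨k, hk⟩
        exact hq ⟨k, hk.symm⟩

theorem range_rootEmb_mono (F : Type*) [Field F] (N M : ℕ+) :
    (rootEmb F N).fieldRange ≤ (rootEmb F (N * M)).fieldRange := by
  intro f hf
  rw [mem_range_rootEmb] at hf ⊢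
  intro q hq
  obtain ⟨k, rfl⟩ := hf q hq
  refine ⟨k * (M : ℕ), ?_⟩
  have hN : ((N : ℕ) : ℚ) ≠ 0 := by exact_mod_cast N.ne_zero
  have hM : ((M : ℕ) : ℚ) ≠ 0 := by exact_mod_cast M.ne_zero
  push_cast
  field_simp

theorem exists_common (F : Type*) [Field F] {f g : HahnSeries ℚ F}
    (hf : f ∈ ⋃ N : ℕ+, ((rootEmb F N).fieldRange : Set (HahnSeries ℚ F)))
    (hg : g ∈ ⋃ N : ℕ+, ((rootEmb F N).fieldRange : Set (HahnSeries ℚ F))) :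
    ∃ N : ℕ+, f ∈ (rootEmb F N).fieldRange ∧ g ∈ (rootEmb F N).fieldRange := by
  obtain ⟨N, hN⟩ := Set.mem_iUnion.1 hf
  obtain ⟨M, hM⟩ := Set.mem_iUnion.1 hg
  refine ⟨N * M, range_rootEmb_mono F N M hN, ?_⟩
  rw [mul_comm]
  exact range_rootEmb_mono F M N hM

/-- The field of Newton-Puiseux series `K = ⋃_{N ≥ 1} F((t ^ (1 / N)))` inside `F((t ^ ℚ))`. -/
def puiseuxField (F : Type*) [Field F] : Subfield (HahnSeries ℚ F) where
  carrier := ⋃ N : ℕ+, ((rootEmb F N).fieldRange : Set (HahnSeries ℚ F))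
  mul_mem' := fun {_ _} hf hg => by
    obtain ⟨N, h1, h2⟩ := exists_common F hf hg
    exact Set.mem_iUnion.2 ⟨N, mul_mem h1 h2⟩
  one_mem' := Set.mem_iUnion.2 ⟨1, one_mem _⟩
  add_mem' := fun {_ _} hf hg => by
    obtain ⟨N, h1, h2⟩ := exists_common F hf hg
    exact Set.mem_iUnion.2 ⟨N, add_mem h1 h2⟩
  zero_mem' := Set.mem_iUnion.2 ⟨1, zero_mem _⟩
  neg_mem' := fun {_} hf => by
    obtain ⟨N, h⟩ := Set.mem_iUnion.1 hf
    exact Set.mem_iUnion.2 ⟨N, neg_mem h⟩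
  inv_mem' := fun _ hf => by
    obtain ⟨N, h⟩ := Set.mem_iUnion.1 hf
    exact Set.mem_iUnion.2 ⟨N, inv_mem h⟩

/-- A Hahn series is a Puiseux series iff the exponents in its support have a common
denominator. -/
theorem mem_puiseuxField_iff {F : Type*} [Field F] {f : HahnSeries ℚ F} :
    f ∈ puiseuxField F ↔
      ∃ N : ℕ+, ∀ q ∈ f.support, ∃ k : ℤ, q = (k : ℚ) / (N : ℕ) := by
  have h : f ∈ puiseuxField F ↔
      f ∈ ⋃ N : ℕ+, ((rootEmb F N).fieldRange : Set (HahnSeries ℚ F)) := Iff.rfl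
  rw [h, Set.mem_iUnion]
  exact exists_congr fun N => mem_range_rootEmb

theorem one_div_pow_bounds (p : ℕ) [Fact p.Prime] (j : ℕ) :
    (0 : ℚ) < 1 / (p : ℚ) ^ (j + 1) ∧ 1 / (p : ℚ) ^ (j + 1) < 1 := by
  have hp : (1 : ℚ) < p := by exact_mod_cast (Fact.out : p.Prime).one_lt
  have h1 : (1 : ℚ) < (p : ℚ) ^ (j + 1) := one_lt_pow₀ hp (Nat.succ_ne_zero j)
  exact ⟨by positivity, by rw [div_lt_one (by positivity)]; exact h1⟩

theorem exponent_strictMono (p : ℕ) [Fact p.Prime] :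
    StrictMono (fun x : ℕ ×ₗ ℕ =>
      ((ofLex x).1 : ℚ) - 1 / (p : ℚ) ^ ((ofLex x).2 + 1)) := by
  have hp : (1 : ℚ) < p := by exact_mod_cast (Fact.out : p.Prime).one_lt
  intro x y hxy
  have hx := one_div_pow_bounds p (ofLex x).2
  have hy := one_div_pow_bounds p (ofLex y).2
  rcases (Prod.Lex.lt_iff).1 hxy with h | ⟨h, h'⟩
  · have : ((ofLex x).1 : ℚ) + 1 ≤ ((ofLex y).1 : ℚ) := by exact_mod_cast h
    dsimp only
    linarith [hx.1, hy.2]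
  · have hlt : (p : ℚ) ^ ((ofLex x).2 + 1) < (p : ℚ) ^ ((ofLex y).2 + 1) :=
      pow_lt_pow_right₀ hp (by omega)
    have := one_div_lt_one_div_of_lt (by positivity) hlt
    dsimp only
    rw [h]
    linarith

theorem isPWO_exponents (p : ℕ) [Fact p.Prime] :
    (Set.range (fun x : ℕ ×ₗ ℕ =>
      ((ofLex x).1 : ℚ) - 1 / (p : ℚ) ^ ((ofLex x).2 + 1))).IsPWO := by
  rw [← Set.image_univ]
  exact (Set.isPWO_of_wellQuasiOrderedLE _).image_of_monotone (exponent_strictMono p).monotone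

/-- The summable family `j ↦ (j choose n) t ^ (-1 / p ^ (j + 1))`, `j ≥ 0`; its terms with
`j < n` vanish. -/
def towerFamily (p : ℕ) [Fact p.Prime] (F : Type*) [Field F] (n : ℕ) :
    HahnSeries.SummableFamily ℚ F ℕ where
  toFun j := HahnSeries.single (-1 / (p : ℚ) ^ (j + 1)) ((j.choose n : ℕ) : F)
  isPWO_iUnion_support' := by
    refine (isPWO_exponents p).mono ?_
    intro q hq
    obtain ⟨j, hj⟩ := Set.mem_iUnion.1 hq
    have h := HahnSeries.support_single_subset hj
    rw [Set.mem_singleton_iff] at h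
    exact ⟨toLex (0, j), by rw [h]; simp [neg_div]⟩
  finite_co_support' q := by
    refine Set.Subsingleton.finite ?_
    intro i hi j hj
    have h1 := Set.mem_singleton_iff.1 (HahnSeries.support_single_subset hi)
    have h2 := Set.mem_singleton_iff.1 (HahnSeries.support_single_subset hj)
    have h3 := (exponent_strictMono p).injective (a₁ := toLex (0, i)) (a₂ := toLex (0, j))
      (by have := h1.symm.trans h2; simpa [neg_div] using this)
    simpa using h3

/-- `s_n = ∑_{j ≥ n} (j choose n) t ^ (-1 / p ^ (j + 1))`. -/
def towerSeries (p : ℕ) [Fact p.Prime] (F : Type*) [Field F] (n : ℕ) : HahnSeries ℚ F :=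
  (towerFamily p F n).hsum

theorem support_shift_subset (p : ℕ) [Fact p.Prime] (F : Type*) [Field F] (n : ℕ) {q : ℚ}
    (hq : q ∈ (HahnSeries.single (n : ℚ) (1 : F) * towerSeries p F n).support) :
    ∃ j : ℕ, q = (n : ℚ) - 1 / (p : ℚ) ^ (j + 1) := by
  obtain ⟨a, ha, b, hb, rfl⟩ := Set.mem_add.1 (HahnSeries.support_mul_subset hq)
  have h1 := Set.mem_singleton_iff.1 (HahnSeries.support_single_subset ha)
  obtain ⟨j, hj⟩ := Set.mem_iUnion.1 (HahnSeries.SummableFamily.support_hsum_subset hb)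
  have h2 := Set.mem_singleton_iff.1 (HahnSeries.support_single_subset hj)
  exact ⟨j, by rw [h1, h2]; ring⟩

/-- The summable family `n ↦ t ^ n * s_n`, `n ≥ 0`. -/
def shiftedFamily (p : ℕ) [Fact p.Prime] (F : Type*) [Field F] :
    HahnSeries.SummableFamily ℚ F ℕ where
  toFun n := HahnSeries.single (n : ℚ) (1 : F) * towerSeries p F n
  isPWO_iUnion_support' := by
    refine (isPWO_exponents p).mono ?_
    intro q hq
    obtain ⟨n, hn⟩ := Set.mem_iUnion.1 hq
    obtain ⟨j, rfl⟩ := support_shift_subset p F n hn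
    exact ⟨toLex (n, j), rfl⟩
  finite_co_support' q := by
    refine Set.Subsingleton.finite ?_
    intro n hn m hm
    obtain ⟨i, hi⟩ := support_shift_subset p F n hn
    obtain ⟨j, hj⟩ := support_shift_subset p F m hm
    have h3 := (exponent_strictMono p).injective (a₁ := toLex (n, i)) (a₂ := toLex (m, j))
      (hi.symm.trans hj)
    have h4 : (n, i) = (m, j) := toLex.injective h3
    exact (Prod.mk.inj h4).1

/-- `s = ∑_{n ≥ 0} t ^ n s_n`. -/
def sSeries (p : ℕ) [Fact p.Prime] (F : Type*) [Field F] : HahnSeries ℚ F :=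
  (shiftedFamily p F).hsum

end PuiseuxHahn

end

/-!
Summing first over `n` gives `s = ∑_j (1 + t) ^ j t ^ (-1 / p ^ (j + 1))`. If `s` were algebraic,
its powers `s ^ (p ^ i)` would satisfy a nontrivial relation `∑ a_i s ^ (p ^ i) = 0` over `K`. The
exponents of the `a_i` have `p`-adic norm at most some `B ≥ 1`, so the relation holds separately on
each coset of `{q | |q|_p ≤ B}`. As Frobenius multiplies exponents by `p`, when `B < p ^ (m + 1)`
the only term of `s` contributing to `s ^ (p ^ i)` on the coset of `-1 / p ^ (m + 1)` is the one
with `j = i + m`, and it contributes `t ^ (-1 / p ^ (m + 1)) (1 + t ^ (p ^ i)) ^ (i + m)`. Hence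
`∑ a_i (1 + t ^ (p ^ i)) ^ (i + m) = 0` for all large `m`, and independence of the characters
`m ↦ (1 + t ^ (p ^ i)) ^ m` forces every `a_i` to vanish.
-/

namespace PuiseuxHahn

section Restrict

variable {Γ R : Type*} [PartialOrder Γ]

/-- The part of a Hahn series with exponents in `s`. Applied to half-lines it truncates a series,
applied to cosets of a subgroup `A` it gives the components of the series over the series with
exponents in `A`. -/
noncomputable def restrict [Zero R] (s : Set Γ) (f : HahnSeries Γ R) : HahnSeries Γ R where
  coeff := s.indicator f.coeff
  isPWO_support' := f.isPWO_support.mono <| by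
    rw [Set.support_indicator]
    exact Set.inter_subset_right

theorem coeff_restrict [Zero R] (s : Set Γ) (f : HahnSeries Γ R) :
    (restrict s f).coeff = s.indicator f.coeff :=
  rfl

theorem support_restrict [Zero R] (s : Set Γ) (f : HahnSeries Γ R) :
    (restrict s f).support = s ∩ f.support :=
  Set.support_indicator

theorem restrict_sum [AddCommMonoid R] {ι : Type*} (s : Set Γ) (I : Finset ι)
    (f : ι → HahnSeries Γ R) : restrict s (∑ i ∈ I, f i) = ∑ i ∈ I, restrict s (f i) := by
  ext q
  by_cases hq : q ∈ s <;> simp [coeff_restrict, HahnSeries.coeff_sum, hq]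

theorem restrict_mul_of_add_mem_iff [AddCommMonoid Γ] [IsOrderedCancelAddMonoid Γ]
    [NonUnitalNonAssocSemiring R] {s : Set Γ} {a : HahnSeries Γ R}
    (ha : ∀ x ∈ a.support, ∀ y, x + y ∈ s ↔ y ∈ s) (f : HahnSeries Γ R) :
    restrict s (a * f) = a * restrict s f := by
  have h_supp : (restrict s f).support ⊆ f.support :=
    (support_restrict s f).trans_subset Set.inter_subset_right
  ext q
  rw [HahnSeries.coeff_mul_right' f.isPWO_support h_supp]
  by_cases hq : q ∈ s
  · rw [coeff_restrict, Set.indicator_of_mem hq, HahnSeries.coeff_mul]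
    refine Finset.sum_congr rfl fun ⟨x, y⟩ hxy => ?_
    obtain ⟨hx, -, rfl⟩ := Finset.mem_antidiagonal.1 hxy
    rw [coeff_restrict, Set.indicator_of_mem ((ha x hx y).1 hq)]
  · rw [coeff_restrict, Set.indicator_of_notMem hq, eq_comm]
    refine Finset.sum_eq_zero fun ⟨x, y⟩ hxy => ?_
    obtain ⟨hx, -, rfl⟩ := Finset.mem_antidiagonal.1 hxy
    rw [coeff_restrict, Set.indicator_of_notMem (mt (ha x hx y).2 hq), mul_zero]

end Restrict

theorem restrict_Iio_add_single_add_restrict_Ioi {Γ R : Type*} [LinearOrder Γ] [AddMonoid R]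
    (f : HahnSeries Γ R) (q : Γ) :
    restrict (Set.Iio q) f + HahnSeries.single q (f.coeff q) + restrict (Set.Ioi q) f = f := by
  ext x
  rcases lt_trichotomy x q with h | rfl | h
  · simp [coeff_restrict, h, h.ne, h.le]
  · simp [coeff_restrict]
  · simp [coeff_restrict, h, h.ne', h.le]

section Frobenius

open scoped Pointwise in
theorem support_pow_subset_nsmul {Γ R : Type*} [AddCommMonoid Γ] [PartialOrder Γ]
    [IsOrderedCancelAddMonoid Γ] [Semiring R] (f : HahnSeries Γ R) (n : ℕ) :
    (f ^ n).support ⊆ n • f.support := by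
  induction n with
  | zero =>
    rw [pow_zero, zero_nsmul]
    exact HahnSeries.support_single_subset
  | succ n ih =>
    rw [pow_succ, succ_nsmul]
    exact HahnSeries.support_mul_subset.trans (Set.add_subset_add_right ih)

variable {Γ R : Type*} [AddCommMonoid Γ] [LinearOrder Γ] [IsOrderedCancelAddMonoid Γ]

open scoped Pointwise in
theorem exists_le_and_exists_ge_of_nsmul_mem_support_pow [Semiring R] {f : HahnSeries Γ R} {n : ℕ}
    (hn : n ≠ 0) {q : Γ} (hq : n • q ∈ (f ^ n).support) :
    (∃ x ∈ f.support, x ≤ q) ∧ ∃ x ∈ f.support, q ≤ x := by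
  have h : ∑ _i ∈ Finset.range n, q ∈ ∑ _i ∈ Finset.range n, f.support := by
    simpa using support_pow_subset_nsmul f n hq
  obtain ⟨x, hx, h_sum⟩ := (Set.mem_finsetSum _ _ _).1 h
  have h_range := Finset.nonempty_range_iff.2 hn
  obtain ⟨i, hi, hi_le⟩ := Finset.exists_le_of_sum_le h_range h_sum.le
  obtain ⟨j, hj, hj_ge⟩ := Finset.exists_le_of_sum_le h_range h_sum.ge
  exact ⟨⟨x i, hx hi, hi_le⟩, ⟨x j, hx hj, hj_ge⟩⟩

variable [CommSemiring R] (p : ℕ) [ExpChar R p]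

theorem coeff_pow_expChar_pow (f : HahnSeries Γ R) (i : ℕ) (q : Γ) :
    (f ^ p ^ i).coeff (p ^ i • q) = f.coeff q ^ p ^ i := by
  have : ExpChar (HahnSeries Γ R) p := expChar_of_injective_ringHom HahnSeries.C_injective p
  have hp : p ^ i ≠ 0 := pow_ne_zero i (expChar_pos R p).ne'
  have h_low : (restrict (Set.Iio q) f ^ p ^ i).coeff (p ^ i • q) = 0 := by
    by_contra h
    obtain ⟨-, x, hx, hqx⟩ := exists_le_and_exists_ge_of_nsmul_mem_support_pow hp h
    rw [support_restrict] at hx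
    exact hx.1.not_ge hqx
  have h_high : (restrict (Set.Ioi q) f ^ p ^ i).coeff (p ^ i • q) = 0 := by
    by_contra h
    obtain ⟨⟨x, hx, hxq⟩, -⟩ := exists_le_and_exists_ge_of_nsmul_mem_support_pow hp h
    rw [support_restrict] at hx
    exact hx.1.not_ge hxq
  conv_lhs => rw [← restrict_Iio_add_single_add_restrict_Ioi f q]
  rw [add_pow_expChar_pow, add_pow_expChar_pow, HahnSeries.coeff_add, HahnSeries.coeff_add,
    h_low, h_high, HahnSeries.single_pow, HahnSeries.coeff_single_same, zero_add, add_zero]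

theorem restrict_pow_expChar_pow {i : ℕ} (h_surj : Function.Surjective fun q : Γ => p ^ i • q)
    (s : Set Γ) (f : HahnSeries Γ R) :
    restrict s (f ^ p ^ i) = restrict {q | p ^ i • q ∈ s} f ^ p ^ i := by
  have hp : p ^ i ≠ 0 := pow_ne_zero i (expChar_pos R p).ne'
  ext q
  obtain ⟨q, rfl⟩ := h_surj q
  rw [coeff_pow_expChar_pow, coeff_restrict, coeff_restrict]
  by_cases hq : p ^ i • q ∈ s
  · rw [Set.indicator_of_mem hq, Set.indicator_of_mem (s := {q | p ^ i • q ∈ s}) hq,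
      coeff_pow_expChar_pow]
  · rw [Set.indicator_of_notMem hq, Set.indicator_of_notMem (s := {q | p ^ i • q ∈ s}) hq,
      zero_pow hp]

end Frobenius

section PadicNorm

variable (p : ℕ) [Fact p.Prime]

theorem padicNorm_add_le_iff {x B : ℚ} (hx : padicNorm p x ≤ B) (y : ℚ) :
    padicNorm p (x + y) ≤ B ↔ padicNorm p y ≤ B := by
  refine ⟨fun h => ?_, fun h => padicNorm.nonarchimedean.trans (max_le hx h)⟩
  rw [← add_sub_cancel_left x y]
  exact padicNorm.sub.trans (max_le h hx)

theorem padicNorm_pow_div_pow (i j : ℕ) :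
    padicNorm p ((p : ℚ) ^ i / (p : ℚ) ^ j) = (p : ℚ) ^ j / (p : ℚ) ^ i := by
  rw [padicNorm.div, IsAbsoluteValue.abv_pow (padicNorm p), IsAbsoluteValue.abv_pow (padicNorm p),
    padicNorm.padicNorm_p_of_prime, inv_pow, inv_pow, inv_div_inv]

/-- The closed `p`-adic ball in `ℚ`. It serves as a coset of the additive group of the rationals of
`p`-adic norm at most `B`. -/
def padicClosedBall (c B : ℚ) : Set ℚ :=
  {q | padicNorm p (q - c) ≤ B}

theorem add_mem_padicClosedBall_iff {x B : ℚ} (hx : padicNorm p x ≤ B) (c y : ℚ) :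
    x + y ∈ padicClosedBall p c B ↔ y ∈ padicClosedBall p c B := by
  rw [padicClosedBall, Set.mem_ofPred_eq, add_sub_assoc]
  exact padicNorm_add_le_iff p hx (y - c)

theorem pow_nsmul_exponent_mem_padicClosedBall_iff {B : ℚ} {m : ℕ} (hB : 1 ≤ B)
    (hm : B < (p : ℚ) ^ (m + 1)) (i n j : ℕ) :
    p ^ i • ((n : ℚ) - 1 / (p : ℚ) ^ (j + 1)) ∈ padicClosedBall p (-1 / (p : ℚ) ^ (m + 1)) B ↔
      j = i + m := by
  have hp : (p : ℚ) ≠ 0 := mod_cast (Fact.out : p.Prime).ne_zero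
  have h_int : padicNorm p ((p ^ i * n : ℕ) : ℚ) ≤ B := (padicNorm.of_nat _).trans hB
  have h_diff : p ^ i • ((n : ℚ) - 1 / (p : ℚ) ^ (j + 1)) - -1 / (p : ℚ) ^ (m + 1) =
      ((p ^ i * n : ℕ) : ℚ) + (1 / (p : ℚ) ^ (m + 1) + -((p : ℚ) ^ i / (p : ℚ) ^ (j + 1))) := by
    rw [nsmul_eq_mul]
    push_cast
    ring
  rw [padicClosedBall, Set.mem_ofPred_eq, h_diff, padicNorm_add_le_iff p h_int]
  constructor
  · contrapose!
    intro hj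
    have h_left : padicNorm p (1 / (p : ℚ) ^ (m + 1)) = (p : ℚ) ^ (m + 1) := by
      simpa using padicNorm_pow_div_pow p 0 (m + 1)
    have h_right : padicNorm p (-((p : ℚ) ^ i / (p : ℚ) ^ (j + 1))) =
        (p : ℚ) ^ (j + 1) / (p : ℚ) ^ i := by
      rw [padicNorm.neg, padicNorm_pow_div_pow]
    have h_ne : (p : ℚ) ^ (m + 1) ≠ (p : ℚ) ^ (j + 1) / (p : ℚ) ^ i := by
      rw [ne_eq, eq_div_iff (pow_ne_zero i hp), ← pow_add]
      norm_cast
      rw [Nat.pow_right_inj (Fact.out : p.Prime).one_lt]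
      lia
    rw [padicNorm.add_eq_max_of_ne (by rwa [h_left, h_right]), h_left]
    exact lt_max_of_lt_left hm
  · rintro rfl
    have h_eq : 1 / (p : ℚ) ^ (m + 1) = (p : ℚ) ^ i / (p : ℚ) ^ (i + m + 1) := by
      rw [add_assoc, pow_add _ i, ← div_div, div_self (pow_ne_zero i hp)]
    rw [h_eq, add_neg_cancel, padicNorm.zero]
    exact zero_le_one.trans hB

theorem exists_padicNorm_le_of_mem_puiseuxField {F : Type*} [Field F] {f : HahnSeries ℚ F}
    (hf : f ∈ puiseuxField F) : ∃ B : ℚ, ∀ q ∈ f.support, padicNorm p q ≤ B := by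
  obtain ⟨N, hN⟩ := mem_puiseuxField_iff.1 hf
  refine ⟨1 / padicNorm p (N : ℕ), fun q hq => ?_⟩
  obtain ⟨k, rfl⟩ := hN q hq
  rw [padicNorm.div]
  gcongr
  · exact padicNorm.nonneg _
  · exact padicNorm.of_int k

end PadicNorm

section OfPowerSeries

variable (Γ R : Type*) [Semiring Γ] [PartialOrder Γ] [IsStrictOrderedRing Γ] [Semiring R]

theorem support_ofPowerSeries_subset (f : PowerSeries R) :
    (HahnSeries.ofPowerSeries Γ R f).support ⊆ Set.range ((↑) : ℕ → Γ) :=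
  HahnSeries.support_embDomain_subset.trans (Set.image_subset_range _ _)

theorem one_add_single_one_pow (j : ℕ) :
    (1 + HahnSeries.single (1 : Γ) (1 : R)) ^ j =
      HahnSeries.ofPowerSeries Γ R (((1 + Polynomial.X) ^ j : Polynomial R) : PowerSeries R) := by
  simp

theorem coeff_one_add_single_one_pow (j n : ℕ) :
    ((1 + HahnSeries.single (1 : Γ) (1 : R)) ^ j).coeff (n : Γ) = (j.choose n : R) := by
  rw [one_add_single_one_pow, HahnSeries.ofPowerSeries_apply_coeff, Polynomial.coeff_coe,
    Polynomial.coeff_one_add_X_pow]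

end OfPowerSeries

section SSeries

variable (p : ℕ) [Fact p.Prime] (F : Type*) [Field F]

theorem exponent_inj {n j n' j' : ℕ} :
    (n : ℚ) - 1 / (p : ℚ) ^ (j + 1) = (n' : ℚ) - 1 / (p : ℚ) ^ (j' + 1) ↔ n = n' ∧ j = j' := by
  refine ⟨fun h => ?_, by rintro ⟨rfl, rfl⟩; rfl⟩
  exact Prod.mk.inj <| toLex.injective <|
    (exponent_strictMono p).injective (a₁ := toLex (n, j)) (a₂ := toLex (n', j')) h

theorem coeff_towerSeries (n j : ℕ) :
    (towerSeries p F n).coeff (-1 / (p : ℚ) ^ (j + 1)) = (j.choose n : F) := by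
  refine HahnSeries.SummableFamily.coeff_hsum.trans ?_
  rw [finsum_eq_single _ j]
  · exact HahnSeries.coeff_single_same _ _
  · intro k hk
    refine HahnSeries.coeff_single_of_ne fun h => hk.symm ?_
    refine ((exponent_inj p (n := 0) (n' := 0)).1 ?_).2
    linear_combination h

theorem coeff_sSeries (n j : ℕ) :
    (sSeries p F).coeff ((n : ℚ) - 1 / (p : ℚ) ^ (j + 1)) = (j.choose n : F) := by
  refine HahnSeries.SummableFamily.coeff_hsum.trans ?_
  rw [finsum_eq_single _ n]
  · change (HahnSeries.single (n : ℚ) (1 : F) * towerSeries p F n).coeff _ = _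
    rw [HahnSeries.coeff_single_mul, one_mul, ← coeff_towerSeries p, neg_div, sub_sub_cancel_left]
  · intro m hm
    by_contra h
    obtain ⟨k, hk⟩ := support_shift_subset p F m h
    exact hm ((exponent_inj p).1 hk).1.symm

theorem exists_of_mem_support_sSeries {q : ℚ} (hq : q ∈ (sSeries p F).support) :
    ∃ n j : ℕ, q = (n : ℚ) - 1 / (p : ℚ) ^ (j + 1) := by
  obtain ⟨n, hn⟩ := Set.mem_iUnion.1 (HahnSeries.SummableFamily.support_hsum_subset hq)
  exact ⟨n, support_shift_subset p F n hn⟩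

theorem restrict_sSeries {s : Set ℚ} {j : ℕ}
    (hs : ∀ n k : ℕ, (n : ℚ) - 1 / (p : ℚ) ^ (k + 1) ∈ s ↔ k = j) :
    restrict s (sSeries p F) =
      HahnSeries.single (-1 / (p : ℚ) ^ (j + 1)) 1 * (1 + HahnSeries.single 1 1) ^ j := by
  ext q
  rw [HahnSeries.coeff_single_mul, one_mul]
  by_cases hq : ∃ n : ℕ, q = (n : ℚ) - 1 / (p : ℚ) ^ (j + 1)
  · obtain ⟨n, rfl⟩ := hq
    rw [coeff_restrict, Set.indicator_of_mem ((hs n j).2 rfl), coeff_sSeries, neg_div,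
      sub_neg_eq_add, sub_add_cancel, coeff_one_add_single_one_pow]
  · trans 0
    · by_contra h
      rw [← ne_eq, ← HahnSeries.mem_support, support_restrict] at h
      obtain ⟨hqs, hq_supp⟩ := h
      obtain ⟨n, k, rfl⟩ := exists_of_mem_support_sSeries p F hq_supp
      exact hq ⟨n, by rw [(hs n k).1 hqs]⟩
    · by_contra h
      rw [one_add_single_one_pow, eq_comm, ← ne_eq, ← HahnSeries.mem_support] at h
      obtain ⟨n, hn⟩ := support_ofPowerSeries_subset ℚ F _ h
      exact hq ⟨n, by linear_combination -hn⟩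

theorem restrict_sSeries_pow [CharP F p] {B : ℚ} {m : ℕ} (hB : 1 ≤ B)
    (hm : B < (p : ℚ) ^ (m + 1)) (i : ℕ) :
    restrict (padicClosedBall p (-1 / (p : ℚ) ^ (m + 1)) B) (sSeries p F ^ p ^ i) =
      HahnSeries.single (-1 / (p : ℚ) ^ (m + 1)) 1 *
        (1 + HahnSeries.single ((p : ℚ) ^ i) 1) ^ (i + m) := by
  have hp : (p : ℚ) ≠ 0 := mod_cast (Fact.out : p.Prime).ne_zero
  have : ExpChar F p := .prime Fact.out
  have : ExpChar (HahnSeries ℚ F) p := expChar_of_injective_ringHom HahnSeries.C_injective p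
  have h_surj : Function.Surjective fun q : ℚ => p ^ i • q := fun q =>
    ⟨q / (p : ℚ) ^ i, by simp [mul_div_cancel₀, hp]⟩
  have h_exp : p ^ i • (-1 / (p : ℚ) ^ (i + m + 1)) = -1 / (p : ℚ) ^ (m + 1) := by
    rw [nsmul_eq_mul, add_assoc, pow_add]
    push_cast
    field_simp
  rw [restrict_pow_expChar_pow p h_surj,
    restrict_sSeries p F fun n k => pow_nsmul_exponent_mem_padicClosedBall_iff p hB hm i n k,
    mul_pow, HahnSeries.single_pow, one_pow, h_exp, pow_right_comm, add_pow_expChar_pow, one_pow,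
    HahnSeries.single_pow, one_pow, nsmul_one, Nat.cast_pow]

end SSeries

theorem one_add_single_ne_zero {Γ R : Type*} [Zero Γ] [PartialOrder Γ] [Semiring R]
    [Nontrivial R] {q : Γ} (hq : q ≠ 0) :
    1 + HahnSeries.single q (1 : R) ≠ 0 := fun h => by
  simpa [HahnSeries.coeff_single_of_ne hq.symm] using congrArg (HahnSeries.coeff · 0) h

theorem eq_zero_of_forall_sum_mul_pow_eq_zero {ι R : Type*} [CommRing R] [IsDomain R]
    {x : ι → R} (hx : Function.Injective x) {I : Finset ι} {v : ι → R}
    (h : ∀ l : ℕ, ∑ i ∈ I, v i * x i ^ l = 0) : ∀ i ∈ I, v i = 0 := by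
  have h_dedekind : LinearIndependent R fun i => ⇑(powersHom R (x i)) :=
    (linearIndependent_monoidHom (Multiplicative ℕ) R).comp _ ((powersHom R).injective.comp hx)
  refine linearIndependent_iff'.1 h_dedekind I v (funext fun l => ?_)
  simpa using h l.toAdd

theorem transcendental_of_linearIndependent_pow {K A ι : Type*} [Field K] [Ring A] [Algebra K A]
    [Infinite ι] {x : A} {e : ι → ℕ} (h : LinearIndependent K fun i => x ^ e i) :
    Transcendental K x := by
  intro hx
  have := Algebra.finite_adjoin_simple_of_isIntegral hx.isIntegral
  have h_adjoin : LinearIndependent K fun i =>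
      (⟨x, Algebra.self_mem_adjoin_singleton K x⟩ : Algebra.adjoin K {x}) ^ e i :=
    .of_comp (Algebra.adjoin K {x}).val.toLinearMap h
  have := h_adjoin.finite
  exact not_finite ι

section Transcendence

variable (p : ℕ) [Fact p.Prime] (F : Type*) [Field F] [CharP F p]

theorem sum_mul_one_add_single_pow_eq_zero {I : Finset ℕ} {a : ℕ → HahnSeries ℚ F} {B : ℚ}
    {m : ℕ} (hB : 1 ≤ B) (hm : B < (p : ℚ) ^ (m + 1))
    (ha : ∀ i ∈ I, ∀ q ∈ (a i).support, padicNorm p q ≤ B)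
    (h : ∑ i ∈ I, a i * sSeries p F ^ p ^ i = 0) :
    ∑ i ∈ I, a i * (1 + HahnSeries.single ((p : ℚ) ^ i) 1) ^ (i + m) = 0 := by
  set t := HahnSeries.single (-1 / (p : ℚ) ^ (m + 1)) (1 : F)
  have ht : t ≠ 0 := HahnSeries.single_ne_zero one_ne_zero
  set s := padicClosedBall p (-1 / (p : ℚ) ^ (m + 1)) B
  refine (mul_eq_zero.1 ?_).resolve_left ht
  calc t * ∑ i ∈ I, a i * (1 + HahnSeries.single ((p : ℚ) ^ i) 1) ^ (i + m)
    _ = ∑ i ∈ I, a i * restrict s (sSeries p F ^ p ^ i) := by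
      simp_rw [Finset.mul_sum, s, restrict_sSeries_pow p F hB hm, mul_left_comm t, t]
    _ = ∑ i ∈ I, restrict s (a i * sSeries p F ^ p ^ i) :=
      Finset.sum_congr rfl fun i hi => .symm <| restrict_mul_of_add_mem_iff
        (fun q hq => add_mem_padicClosedBall_iff p (ha i hi q hq) _) _
    _ = restrict s 0 := by rw [← restrict_sum, h]
    _ = 0 := by ext; simp [coeff_restrict]

theorem linearIndependent_sSeries_pow (K : Subfield (HahnSeries ℚ F))
    (hK : ∀ f ∈ K, ∃ B : ℚ, ∀ q ∈ f.support, padicNorm p q ≤ B) :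
    LinearIndependent K fun i : ℕ => sSeries p F ^ p ^ i := by
  have hp : 1 < (p : ℚ) := mod_cast (Fact.out : p.Prime).one_lt
  refine linearIndependent_iff'.2 fun I a h => ?_
  choose b hb using fun i => hK (a i) (a i).2
  obtain ⟨B, hB⟩ := (insert 1 (I.image b)).exists_le
  obtain ⟨m, hm⟩ := pow_unbounded_of_one_lt B hp
  have h_one : 1 ≤ B := hB 1 (Finset.mem_insert_self _ _)
  have h_bound : ∀ i ∈ I, ∀ q ∈ (a i : HahnSeries ℚ F).support, padicNorm p q ≤ B :=
    fun i hi q hq => (hb i q hq).trans <|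
      hB (b i) (Finset.mem_insert_of_mem (Finset.mem_image_of_mem b hi))
  have h_rel (l : ℕ) : ∑ i ∈ I, (a i : HahnSeries ℚ F) *
      (1 + HahnSeries.single ((p : ℚ) ^ i) 1) ^ (i + m) *
        (1 + HahnSeries.single ((p : ℚ) ^ i) 1) ^ l = 0 := by
    have hl : B < (p : ℚ) ^ (m + l + 1) :=
      hm.trans_le (pow_le_pow_right₀ hp.le (by lia))
    simpa only [mul_assoc, ← pow_add, add_assoc] using
      sum_mul_one_add_single_pow_eq_zero p F h_one hl h_bound h
  have h_inj : Function.Injective fun i : ℕ =>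
      1 + HahnSeries.single ((p : ℚ) ^ i) (1 : F) := fun i j hij => by
    have h_order := congrArg HahnSeries.order (add_left_cancel hij)
    rw [HahnSeries.order_single one_ne_zero, HahnSeries.order_single one_ne_zero] at h_order
    exact pow_right_injective₀ (zero_lt_one.trans hp) hp.ne' h_order
  intro i hi
  refine Subtype.ext ((mul_eq_zero.1
    (eq_zero_of_forall_sum_mul_pow_eq_zero h_inj h_rel i hi)).resolve_right ?_)
  exact pow_ne_zero _ (one_add_single_ne_zero (pow_ne_zero i (zero_lt_one.trans hp).ne'))

end Transcendence

end PuiseuxHahn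

theorem mainTheorem3_general (p : ℕ) [Fact p.Prime] (F : Type*) [Field F] [CharP F p]
    (K : Subfield (HahnSeries ℚ F))
    (hK : ∀ f ∈ K, ∃ B : ℚ, ∀ q ∈ f.support, padicNorm p q ≤ B) :
    Transcendental K (PuiseuxHahn.sSeries p F) :=
  PuiseuxHahn.transcendental_of_linearIndependent_pow
    (PuiseuxHahn.linearIndependent_sSeries_pow p F K hK)

theorem mainTheorem3 (p : ℕ) [Fact p.Prime] (F : Type*) [Field F] [Algebra (ZMod p) F]
    [IsAlgClosure (ZMod p) F] :
    Transcendental (PuiseuxHahn.puiseuxField F) (PuiseuxHahn.sSeries p F) :=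
  have : CharP F p := charP_of_injective_algebraMap (algebraMap (ZMod p) F).injective p
  mainTheorem3_general p F _ fun _ => PuiseuxHahn.exists_padicNorm_le_of_mem_puiseuxField p
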